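/- An expansion of the ordered group of reals $(\mathbb R,<,+,0)$ is called *almost o-minimal* if every bounded subset of $\mathbb R$ definable in it (with parameters) is the union of finitely many points and finitely many open intervals. An almost o-minimal expansion of $(\mathbb R,<,+,0)$ is called *periodic* if the set $r\mathbb Z$ is definable in it for some real $r>0$, and *quasi-periodic* if it is a reduct of a periodic almost o-minimal expansion of $(\mathbb R,<,+,0)$. Let $\rho$ be a real number with $\rho>1$ and let $E=\{\rho^n \mid n\in\mathbb Z,\ n\ge 0\}$. Then the structure $(\mathbb R,<,+,0,E)$ is almost o-minimal, and it is quasi-periodic if and only if $\rho$ is an integer. -/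

import Mathlib

namespace QuasiPeriodic

open FirstOrder

/-- The function symbols `0`, `+` of the language of ordered abelian groups. -/
inductive OrdGroupFunc : ℕ → Type
  | zero : OrdGroupFunc 0
  | add : OrdGroupFunc 2

/-- The relation symbol `<` of the language of ordered abelian groups. -/
inductive OrdGroupRel : ℕ → Type
  | lt : OrdGroupRel 2

/-- The language `{<, +, 0}` of ordered abelian groups. -/
def ordGroupLang : FirstOrder.Language.{0, 0} := ⟨OrdGroupFunc, OrdGroupRel⟩

/-- The ordered group of reals `(ℝ, <, +, 0)`. -/
instance ordGroupStructure : ordGroupLang.Structure ℝ where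
  funMap
    | OrdGroupFunc.zero => fun _ => 0
    | OrdGroupFunc.add => fun v => v 0 + v 1
  RelMap
    | OrdGroupRel.lt => fun v => v 0 < v 1

/-- A single unary predicate symbol. -/
inductive UnaryRel : ℕ → Type
  | mem : UnaryRel 1

/-- The language with one unary predicate symbol, tagged by the set that it names, so that its
intended interpretation can be found by instance search. -/
def predLang (_E : Set ℝ) : FirstOrder.Language.{0, 0} := ⟨fun _ => Empty, UnaryRel⟩

/-- The structure `(ℝ, E)`: the predicate symbol is interpreted by the set `E`. -/
instance predStructure (E : Set ℝ) : (predLang E).Structure ℝ where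
  funMap := fun f => f.elim
  RelMap
    | UnaryRel.mem => fun v => v 0 ∈ E

/-- The language `{<, +, 0, E}`. With the instances above, `ℝ` becomes the structure
`(ℝ, <, +, 0, E)` for it. -/
abbrev ordGroupWithLang (E : Set ℝ) : FirstOrder.Language.{0, 0} := ordGroupLang.sum (predLang E)

/-- The set `S` is the union of finitely many points and finitely many open intervals (with
endpoints in `M`, which is no restriction for bounded `S`). -/
def IsFiniteUnionPointsIntervals {M : Type*} [LinearOrder M] (S : Set M) : Prop :=
  ∃ (P : Set M) (I : Set (M × M)), P.Finite ∧ I.Finite ∧ S = P ∪ ⋃ p ∈ I, Set.Ioo p.1 p.2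

/-- The `L`-structure on `ℝ` is an expansion of the ordered group of reals `(ℝ, <, +, 0)`. -/
def ExpandsOrderedGroup (L : FirstOrder.Language.{0, 0}) [L.Structure ℝ] : Prop :=
  ∃ φ : ordGroupLang →ᴸ L, φ.IsExpansionOn ℝ

/-- The `L`-structure on `ℝ` is an almost o-minimal expansion of the ordered group of reals: every
bounded subset of `ℝ` definable with parameters is the union of finitely many points and finitely
many open intervals. -/
def IsAlmostOMinimal (L : FirstOrder.Language.{0, 0}) [L.Structure ℝ] : Prop :=
  ExpandsOrderedGroup L ∧
    ∀ S : Set ℝ, (Set.univ : Set ℝ).Definable₁ L S → BddBelow S → BddAbove S →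
      IsFiniteUnionPointsIntervals S

/-- An almost o-minimal expansion of the ordered group of reals is periodic if the set `rℤ` is
definable in it for some `r > 0`. -/
def IsPeriodic (L : FirstOrder.Language.{0, 0}) [L.Structure ℝ] : Prop :=
  IsAlmostOMinimal L ∧
    ∃ r : ℝ, 0 < r ∧ (Set.univ : Set ℝ).Definable₁ L (Set.range fun z : ℤ => r * (z : ℝ))

/-- An almost o-minimal expansion of the ordered group of reals is quasi-periodic if it is a reduct
of a periodic almost o-minimal expansion of the ordered group of reals. -/
def IsQuasiPeriodic (L : FirstOrder.Language.{0, 0}) [L.Structure ℝ] : Prop :=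
  IsAlmostOMinimal L ∧
    ∃ (L' : FirstOrder.Language.{0, 0}) (_ : L'.Structure ℝ) (φ : L →ᴸ L'),
      φ.IsExpansionOn ℝ ∧ IsPeriodic L'

/-- The increasing geometric progression `{ρ ^ n | n ≥ 0}`. -/
def geomProgression (ρ : ℝ) : Set ℝ := Set.range fun n : ℕ => ρ ^ n

end QuasiPeriodic

/-!
Almost o-minimality is proved by a quantifier elimination that works for every sufficiently sparse
predicate. Fix a family `𝒯` of locally finite sets of reals that contains the singletons and is
closed under sums and rational multiples (`IsSparseFamily`). A subset of `ℝ ^ ι` is called cellular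
(`IsCellular`) if membership of `w` depends only on the positions of finitely many rational linear
forms `l k w` relative to sets of cut points `T k ∈ 𝒯`. Such sets are trivially closed under
Boolean combinations. They are closed under quantification by Fourier–Motzkin elimination
(`exists_sameCell_add`, `IsCellular.forall`): near a given value, local finiteness leaves finitely
many bounds on the eliminated variable, and comparing two bounds means locating a difference of
linear forms relative to a difference of two sets of cut points, again a member of `𝒯`. Hence if the
predicates belong to `𝒯`, all definable sets are cellular, and a bounded cellular subset of the
line is cut out by finitely many cut points.

For `E = {ρ ^ n}` the family consists of the sets of sums `∑ c i * ρ ^ n i` with fixed real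
coefficients. These are locally finite (`isLocallyFinite_geomSums`): factoring out the least power
reduces the number of terms. If `ρ` is an integer, then `E ⊆ ℤ`, and the subsets of the
progressions `(1 / N) ℤ + f` form a family that contains both `E` and `ℤ`; so `(ℝ, <, +, 0, E, ℤ)` is
a periodic almost o-minimal expansion.

Conversely, let `E` and `r ℤ` be definable in an almost o-minimal expansion. The set of residues of
`E` in `[0, r)` is bounded, definable and countable, hence finite (`exists_finite_residues`). So
`ℤ[ρ]` lies in a finitely generated group and `ρ` is an algebraic integer. By the pigeonhole
principle two blocks of consecutive powers have the same residues, and the integral equation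
propagates this to all later powers: `(ρ ^ m - ρ ^ n) * ρ ^ j ∈ r ℤ` for all `j`. Therefore `ρ` is
rational, and so an integer (`exists_int_of_finite_residues`).
-/

namespace QuasiPeriodic

open scoped Pointwise
open FirstOrder FirstOrder.Language FirstOrder.Language.Structure

/-! ### Cells of a locally finite set of cut points -/

/-- No point of `T` separates `a` from `b`: the two reals lie in the same cell of the partition of
the line into the points of `T` and the components of the complement. -/
def SameCell (T : Set ℝ) (a b : ℝ) : Prop :=
  ∀ t ∈ T, (a < t ↔ b < t) ∧ (t < a ↔ t < b)

lemma SameCell.mem_iff {T : Set ℝ} {a b : ℝ} (h : SameCell T a b) : a ∈ T ↔ b ∈ T := by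
  have key : ∀ t ∈ T, a = t ↔ b = t := fun t ht => by
    have := h t ht
    grind
  exact ⟨fun ha => (key a ha).1 rfl ▸ ha, fun hb => (key b hb).2 rfl ▸ hb⟩

lemma SameCell.of_add {T : Set ℝ} {a b c : ℝ} (h : SameCell (T + {-c}) a b) :
    SameCell T (a + c) (b + c) := by
  intro t ht
  have := h (t + -c) (Set.add_mem_add ht rfl)
  grind

lemma SameCell.of_mul {T : Set ℝ} {q : ℚ} (hq : q ≠ 0) {a b : ℝ}
    (h : SameCell ((fun t => ((q⁻¹ : ℚ) : ℝ) * t) '' T) a b) :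
    SameCell T (q * a) (q * b) := by
  intro t ht
  have h1 := h _ ⟨t, ht, rfl⟩
  push_cast at h1
  rcases lt_or_gt_of_ne hq with hq' | hq'
  · have hq0 : (q : ℝ) < 0 := by exact_mod_cast hq'
    have e1 : ∀ x : ℝ, x < (q : ℝ)⁻¹ * t ↔ t < q * x := fun x => by
      rw [inv_mul_eq_div, lt_div_iff_of_neg hq0, mul_comm]
    have e2 : ∀ x : ℝ, (q : ℝ)⁻¹ * t < x ↔ q * x < t := fun x => by
      rw [inv_mul_eq_div, div_lt_iff_of_neg hq0, mul_comm]
    simp only [e1, e2] at h1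
    exact h1.symm
  · have hq0 : (0 : ℝ) < q := by exact_mod_cast hq'
    have e1 : ∀ x : ℝ, x < (q : ℝ)⁻¹ * t ↔ q * x < t := fun x => by
      rw [inv_mul_eq_div, lt_div_iff₀ hq0, mul_comm]
    have e2 : ∀ x : ℝ, (q : ℝ)⁻¹ * t < x ↔ t < q * x := fun x => by
      rw [inv_mul_eq_div, div_lt_iff₀ hq0, mul_comm]
    simp only [e1, e2] at h1
    exact h1

/-- Every bounded piece of `T` is finite. -/
def IsLocallyFinite (T : Set ℝ) : Prop := ∀ M : ℝ, (T ∩ Set.Icc (-M) M).Finite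

lemma IsLocallyFinite.mono {S T : Set ℝ} (hT : IsLocallyFinite T) (h : S ⊆ T) :
    IsLocallyFinite S :=
  fun M => (hT M).subset (Set.inter_subset_inter_left _ h)

lemma IsLocallyFinite.finite_Icc {T : Set ℝ} (hT : IsLocallyFinite T) (a b : ℝ) :
    (T ∩ Set.Icc a b).Finite := by
  refine (hT (max |a| |b|)).subset fun x hx => ⟨hx.1, ?_, ?_⟩
  · have := hx.2.1
    have := neg_abs_le a
    have := le_max_left |a| |b|
    linarith
  · have := hx.2.2
    have := le_abs_self b
    have := le_max_right |a| |b|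
    linarith

lemma IsLocallyFinite.exists_finset_lt {T : Set ℝ} (hT : IsLocallyFinite T) (x : ℝ) :
    ∃ F : Finset ℝ, (∀ f ∈ F, f ∈ T ∧ f < x) ∧ ∀ t ∈ T, t < x → ∃ f ∈ F, t ≤ f := by
  by_cases h : ∃ l ∈ T, l < x
  · obtain ⟨l, hl, hlx⟩ := h
    have hfin : (T ∩ Set.Ico l x).Finite :=
      (hT.finite_Icc l x).subset (Set.inter_subset_inter_right _ Set.Ico_subset_Icc_self)
    refine ⟨hfin.toFinset, fun f hf => ?_, fun t ht htx => ?_⟩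
    · rw [Set.Finite.mem_toFinset] at hf
      exact ⟨hf.1, hf.2.2⟩
    · rcases le_total t l with h1 | h1
      · exact ⟨l, by simp [hl, hlx], h1⟩
      · exact ⟨t, by simp [ht, htx, h1], le_rfl⟩
  · push Not at h
    exact ⟨∅, by simp, fun t ht htx => absurd htx (not_lt.2 (h t ht))⟩

lemma IsLocallyFinite.exists_finset_gt {T : Set ℝ} (hT : IsLocallyFinite T) (x : ℝ) :
    ∃ F : Finset ℝ, (∀ f ∈ F, f ∈ T ∧ x < f) ∧ ∀ t ∈ T, x < t → ∃ f ∈ F, f ≤ t := by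
  by_cases h : ∃ l ∈ T, x < l
  · obtain ⟨l, hl, hlx⟩ := h
    have hfin : (T ∩ Set.Ioc x l).Finite :=
      (hT.finite_Icc x l).subset (Set.inter_subset_inter_right _ Set.Ioc_subset_Icc_self)
    refine ⟨hfin.toFinset, fun f hf => ?_, fun t ht htx => ?_⟩
    · rw [Set.Finite.mem_toFinset] at hf
      exact ⟨hf.1, hf.2.1⟩
    · rcases le_total l t with h1 | h1
      · exact ⟨l, by simp [hl, hlx], h1⟩
      · exact ⟨t, by simp [ht, htx, h1], le_rfl⟩
  · push Not at h
    exact ⟨∅, by simp, fun t ht htx => absurd htx (not_lt.2 (h t ht))⟩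

/-- Fourier–Motzkin elimination of a variable `y` that occurs with coefficient one. If `y` hits a
cut point, that equation determines `y'`; otherwise local finiteness reduces the conditions on `y'`
to finitely many strict lower and upper bounds, and these are compatible because the differences
`v j - v i` and `v' j - v' i` lie in the same cells of the difference sets. -/
lemma exists_sameCell_add {κ : Type} [Finite κ] (S : κ → Set ℝ) (hS : ∀ k, IsLocallyFinite (S k))
    (v v' : κ → ℝ)
    (h : ∀ i j, ∀ t ∈ S i, ∀ s ∈ S j, (v j - v i < s - t ↔ v' j - v' i < s - t) ∧
      (s - t < v j - v i ↔ s - t < v' j - v' i)) (y : ℝ) :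
    ∃ y', ∀ k, SameCell (S k) (v k + y) (v' k + y') := by
  have := Fintype.ofFinite κ
  by_cases heq : ∃ i, v i + y ∈ S i
  · obtain ⟨i, hi⟩ := heq
    refine ⟨v i + y - v' i, fun k s hs => ?_⟩
    have := h i k _ hi s hs
    grind
  · push Not at heq
    choose Lo hLo hLo' using fun k => (hS k).exists_finset_lt (v k + y)
    choose Hi hHi hHi' using fun k => (hS k).exists_finset_gt (v k + y)
    obtain ⟨y', hy1, hy2⟩ := Order.exists_between_finsets
      (lo := Finset.univ.biUnion fun k => (Lo k).image fun l => l - v' k)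
      (hi := Finset.univ.biUnion fun k => (Hi k).image fun l => l - v' k) (by
        intro a ha b hb
        simp only [Finset.mem_biUnion, Finset.mem_univ, Finset.mem_image, true_and] at ha hb
        obtain ⟨i, l, hl, rfl⟩ := ha
        obtain ⟨j, u, hu, rfl⟩ := hb
        have hl' := hLo i l hl
        have hu' := hHi j u hu
        have h1 := (h i j l hl'.1 u hu'.1).1.1 (by linarith)
        linarith)
    have lower : ∀ k, ∀ l ∈ Lo k, l < v' k + y' := fun k l hl => by
      have := hy1 (l - v' k) (by
        simp only [Finset.mem_biUnion, Finset.mem_univ, Finset.mem_image, true_and]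
        exact ⟨k, l, hl, rfl⟩)
      linarith
    have upper : ∀ k, ∀ l ∈ Hi k, v' k + y' < l := fun k l hl => by
      have := hy2 (l - v' k) (by
        simp only [Finset.mem_biUnion, Finset.mem_univ, Finset.mem_image, true_and]
        exact ⟨k, l, hl, rfl⟩)
      linarith
    refine ⟨y', fun k s hs => ?_⟩
    rcases lt_trichotomy (v k + y) s with h1 | h1 | h1
    · obtain ⟨f, hf, hfs⟩ := hHi' k s hs h1
      have := upper k f hf
      grind
    · exact absurd (h1 ▸ hs) (heq k)
    · obtain ⟨f, hf, hfs⟩ := hLo' k s hs h1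
      have := lower k f hf
      grind

/-! ### Sparse families and cellular sets -/

/-- A family of locally finite sets of reals that can serve as sets of cut points: it contains the
singletons and is closed under sums and rational multiples, the operations which the elimination of
a variable performs on cut points. -/
structure IsSparseFamily (𝒯 : Set (Set ℝ)) : Prop where
  isLocallyFinite : ∀ T ∈ 𝒯, IsLocallyFinite T
  singleton_mem : ∀ c : ℝ, {c} ∈ 𝒯
  add_mem : ∀ S ∈ 𝒯, ∀ T ∈ 𝒯, S + T ∈ 𝒯
  mul_mem : ∀ (q : ℚ), ∀ T ∈ 𝒯, (fun t => (q : ℝ) * t) '' T ∈ 𝒯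

/-- The linear functional on `ℝ ^ ι` with rational coefficients `l`. -/
def ratFunctional {ι : Type} [Fintype ι] (l : ι → ℚ) (w : ι → ℝ) : ℝ := ∑ i, (l i : ℝ) * w i

/-- A subset of `ℝ ^ ι` is cellular if finitely many rational functionals `l k`, with sets of cut
points `T k ∈ 𝒯`, decide membership in it: it is a union of cells, each cell prescribing
the position of every `l k` relative to `T k`. The number of cells may be infinite. -/
def IsCellular (𝒯 : Set (Set ℝ)) {ι : Type} [Fintype ι] (X : Set (ι → ℝ)) : Prop :=
  ∃ (κ : Type) (_ : Finite κ) (l : κ → ι → ℚ) (T : κ → Set ℝ), (∀ k, T k ∈ 𝒯) ∧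
    ∀ w w', (∀ k, SameCell (T k) (ratFunctional (l k) w) (ratFunctional (l k) w')) →
      (w ∈ X ↔ w' ∈ X)

section Cellular

variable {𝒯 : Set (Set ℝ)} {ι : Type} [Fintype ι]

lemma isCellular_const (p : Prop) : IsCellular 𝒯 {_w : ι → ℝ | p} :=
  ⟨Empty, inferInstance, Empty.elim, Empty.elim, fun k => k.elim, fun _ _ _ => Iff.rfl⟩

lemma IsCellular.imp {X Y : Set (ι → ℝ)} (hX : IsCellular 𝒯 X) (hY : IsCellular 𝒯 Y) :
    IsCellular 𝒯 {w | w ∈ X → w ∈ Y} := by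
  obtain ⟨κ, _, l, T, hT, h⟩ := hX
  obtain ⟨κ', _, l', T', hT', h'⟩ := hY
  refine ⟨κ ⊕ κ', inferInstance, Sum.elim l l', Sum.elim T T', Sum.rec hT hT', fun w w' hw => ?_⟩
  exact imp_congr (h w w' fun k => hw (Sum.inl k)) (h' w w' fun k => hw (Sum.inr k))

/-- Preimages of cellular sets under rational affine maps are cellular. -/
lemma IsCellular.preimage (h𝒯 : IsSparseFamily 𝒯) {ι' : Type} [Fintype ι'] {X : Set (ι' → ℝ)}
    (hX : IsCellular 𝒯 X) (f : (ι → ℝ) → ι' → ℝ)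
    (hf : ∀ j, ∃ (l : ι → ℚ) (c : ℝ), ∀ w, f w j = ratFunctional l w + c) :
    IsCellular 𝒯 (f ⁻¹' X) := by
  choose A c hA using hf
  obtain ⟨κ, _, l, T, hT, h⟩ := hX
  have key : ∀ k w, ratFunctional (l k) (f w) =
      ratFunctional (fun i => ∑ j, l k j * A j i) w + ∑ j, (l k j : ℝ) * c j := by
    intro k w
    simp only [ratFunctional, hA, mul_add, Finset.sum_add_distrib, Finset.mul_sum, Rat.cast_sum,
      Rat.cast_mul, Finset.sum_mul, mul_assoc]
    rw [Finset.sum_comm]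
  refine ⟨κ, inferInstance, fun k i => ∑ j, l k j * A j i,
    fun k => T k + {-∑ j, (l k j : ℝ) * c j},
    fun k => h𝒯.add_mem _ (hT k) _ (h𝒯.singleton_mem _), fun w w' hw => h _ _ fun k => ?_⟩
  rw [key, key]
  exact (hw k).of_add

lemma isCellular_mem {T : Set ℝ} (hT : T ∈ 𝒯) [DecidableEq ι] (i : ι) :
    IsCellular 𝒯 {w : ι → ℝ | w i ∈ T} := by
  refine ⟨Unit, inferInstance, fun _ => Pi.single i 1, fun _ => T, fun _ => hT, fun w w' h => ?_⟩
  have key : ∀ w : ι → ℝ, ratFunctional (Pi.single i 1) w = w i := fun w => by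
    simp [ratFunctional, Pi.single_apply, apply_ite (Rat.cast : ℚ → ℝ)]
  have := (h ()).mem_iff
  rwa [key, key] at this

lemma ratFunctional_two (w : Fin 2 → ℝ) : ratFunctional ![1, -1] w = w 0 - w 1 := by
  simp [ratFunctional, Fin.sum_univ_two]
  ring

lemma isCellular_lt (h𝒯 : IsSparseFamily 𝒯) : IsCellular 𝒯 {w : Fin 2 → ℝ | w 0 < w 1} := by
  refine ⟨Unit, inferInstance, fun _ => ![1, -1], fun _ => {0}, fun _ => h𝒯.singleton_mem 0,
    fun w w' h => ?_⟩
  have := (h () 0 rfl).1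
  simpa only [ratFunctional_two, sub_neg, Set.mem_ofPred_eq] using this

lemma isCellular_eq (h𝒯 : IsSparseFamily 𝒯) : IsCellular 𝒯 {w : Fin 2 → ℝ | w 0 = w 1} := by
  refine ⟨Unit, inferInstance, fun _ => ![1, -1], fun _ => {0}, fun _ => h𝒯.singleton_mem 0,
    fun w w' h => ?_⟩
  have := (h ()).mem_iff
  simpa only [ratFunctional_two, Set.mem_singleton_iff, sub_eq_zero, Set.mem_ofPred_eq] using this

/-- Universal quantification over one coordinate preserves cellularity. -/
lemma IsCellular.forall (h𝒯 : IsSparseFamily 𝒯) {α : Type} [Fintype α] {n : ℕ}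
    {X : Set (α ⊕ Fin (n + 1) → ℝ)} (hX : IsCellular 𝒯 X) :
    IsCellular 𝒯 {w : α ⊕ Fin n → ℝ |
      ∀ y, Sum.elim (w ∘ Sum.inl) (Fin.snoc (w ∘ Sum.inr) y : Fin (n + 1) → ℝ) ∈ X} := by
  obtain ⟨κ, _, l, T, hT, h⟩ := hX
  let l' : κ → α ⊕ Fin n → ℚ := fun k => l k ∘ Sum.map id Fin.castSucc
  let a : κ → ℚ := fun k => l k (Sum.inr (Fin.last n))
  have key : ∀ k (w : α ⊕ Fin n → ℝ) (y : ℝ), ratFunctional (l k)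
      (Sum.elim (w ∘ Sum.inl) (Fin.snoc (w ∘ Sum.inr) y : Fin (n + 1) → ℝ)) =
      ratFunctional (l' k) w + a k * y := by
    intro k w y
    simp [ratFunctional, l', a, Fintype.sum_sum_type, Fin.sum_univ_castSucc, add_assoc]
  let S : κ → Set ℝ := fun k => (fun t => (((a k)⁻¹ : ℚ) : ℝ) * t) '' T k
  have hSmem : ∀ k, S k ∈ 𝒯 := fun k => h𝒯.mul_mem _ _ (hT k)
  -- Functionals not involving the last coordinate are kept; the others are normalized to have
  -- coefficient one there, and all pairwise differences are recorded. (For `a k = 0` the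
  -- normalization yields the zero functional, which is harmless.)
  let m : κ × κ → α ⊕ Fin n → ℚ := fun p i => (a p.2)⁻¹ * l' p.2 i - (a p.1)⁻¹ * l' p.1 i
  have hm : ∀ p w, ratFunctional (m p) w =
      ((a p.2)⁻¹ : ℚ) * ratFunctional (l' p.2) w - ((a p.1)⁻¹ : ℚ) * ratFunctional (l' p.1) w := by
    intro p w
    simp only [ratFunctional, m, Finset.mul_sum, ← Finset.sum_sub_distrib]
    refine Finset.sum_congr rfl fun i _ => ?_
    push_cast
    ring
  refine ⟨κ ⊕ κ × κ, inferInstance, Sum.elim l' m,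
    Sum.elim T fun p => S p.2 + (fun t => ((-1 : ℚ) : ℝ) * t) '' S p.1,
    Sum.rec hT fun p => h𝒯.add_mem _ (hSmem _) _ (h𝒯.mul_mem _ _ (hSmem _)), ?_⟩
  have oneway : ∀ w w', (∀ k, SameCell (T k) (ratFunctional (l' k) w) (ratFunctional (l' k) w')) →
      (∀ p : κ × κ, SameCell (S p.2 + (fun t => ((-1 : ℚ) : ℝ) * t) '' S p.1)
        (ratFunctional (m p) w) (ratFunctional (m p) w')) →
      ∀ y, ∃ y', ∀ k, SameCell (T k) (ratFunctional (l' k) w + a k * y)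
        (ratFunctional (l' k) w' + a k * y') := by
    intro w w' h1 h2 y
    obtain ⟨y', hy'⟩ := exists_sameCell_add S (fun k => h𝒯.isLocallyFinite _ (hSmem k))
      (fun k => ((a k)⁻¹ : ℚ) * ratFunctional (l' k) w)
      (fun k => ((a k)⁻¹ : ℚ) * ratFunctional (l' k) w') (by
        intro i j t ht s hs
        have := h2 (i, j) (s + ((-1 : ℚ) : ℝ) * t) (Set.add_mem_add hs ⟨t, ht, rfl⟩)
        rw [hm, hm] at this
        have e : s + ((-1 : ℚ) : ℝ) * t = s - t := by push_cast; ring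
        rwa [e] at this) y
    refine ⟨y', fun k => ?_⟩
    by_cases hk : a k = 0
    · simpa [hk] using h1 k
    · have := (hy' k).of_mul hk
      have hk' : (a k : ℝ) ≠ 0 := by exact_mod_cast hk
      push_cast at this
      rwa [mul_add, mul_add, mul_inv_cancel_left₀ hk', mul_inv_cancel_left₀ hk'] at this
  have symm : ∀ {T : Set ℝ} {a b : ℝ}, SameCell T a b → SameCell T b a :=
    fun h t ht => ⟨(h t ht).1.symm, (h t ht).2.symm⟩
  intro w w' hw
  have h1 := fun k => hw (Sum.inl k)
  have h2 := fun p => hw (Sum.inr p)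
  constructor
  · intro hX y'
    obtain ⟨y, hy⟩ := oneway w' w (fun k => symm (h1 k)) (fun p => symm (h2 p)) y'
    refine (h _ _ fun k => ?_).2 (hX y)
    rw [key, key]
    exact hy k
  · intro hX y
    obtain ⟨y', hy⟩ := oneway w w' h1 h2 y
    refine (h _ _ fun k => ?_).2 (hX y')
    rw [key, key]
    exact hy k

end Cellular

/-- A bounded set of reals which finitely many cut points decide is a finite union of points and
open intervals. -/
lemma isFiniteUnionPointsIntervals_of_sameCell {X B : Set ℝ} (hB : B.Finite)
    (hlo : ∀ x ∈ X, ∃ b ∈ B, b < x) (hhi : ∀ x ∈ X, ∃ b ∈ B, x < b)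
    (h : ∀ x ∈ X, ∀ y, SameCell B x y → y ∈ X) : IsFiniteUnionPointsIntervals X := by
  refine ⟨X ∩ B, {p ∈ B ×ˢ B | Set.Ioo p.1 p.2 ⊆ X}, hB.inter_of_right _,
    (hB.prod hB).subset (Set.sep_subset _ _), Set.Subset.antisymm (fun x hx => ?_) ?_⟩
  · by_cases hxB : x ∈ B
    · exact Or.inl ⟨hx, hxB⟩
    right
    obtain ⟨a, ha, hamax⟩ := Set.exists_max_image (B ∩ Set.Iio x) id (hB.inter_of_left _)
      (by obtain ⟨b, hb, hbx⟩ := hlo x hx; exact ⟨b, hb, hbx⟩)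
    obtain ⟨c, hc, hcmin⟩ := Set.exists_min_image (B ∩ Set.Ioi x) id (hB.inter_of_left _)
      (by obtain ⟨b, hb, hbx⟩ := hhi x hx; exact ⟨b, hb, hbx⟩)
    refine Set.mem_biUnion (x := (a, c)) ⟨⟨ha.1, hc.1⟩, fun y hy => h x hx y fun b hb => ?_⟩
      ⟨ha.2, hc.2⟩
    have hy1 := hy.1
    have hy2 := hy.2
    rcases lt_trichotomy x b with hxb | hxb | hxb
    · have := hcmin b ⟨hb, hxb⟩
      simp only [id] at *
      grind
    · exact absurd (hxb ▸ hb) hxB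
    · have := hamax b ⟨hb, hxb⟩
      simp only [id] at *
      grind
  · rintro x (hx | hx)
    · exact hx.1
    · obtain ⟨p, hp, hxp⟩ := Set.mem_iUnion₂.1 hx
      exact hp.2 hxp

/-- Bounded cellular sets of reals are finite unions of points and open intervals: inside a bounded
interval only finitely many cut points matter. -/
lemma IsCellular.isFiniteUnionPointsIntervals {𝒯 : Set (Set ℝ)} (h𝒯 : IsSparseFamily 𝒯)
    {X : Set ℝ} (hX : IsCellular 𝒯 {w : Fin 1 → ℝ | w 0 ∈ X}) (hlo : BddBelow X)
    (hhi : BddAbove X) : IsFiniteUnionPointsIntervals X := by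
  obtain ⟨κ, _, l, T, hT, h⟩ := hX
  obtain ⟨a, ha⟩ := hlo
  obtain ⟨b, hb⟩ := hhi
  let u : ℝ := a - 1
  let v : ℝ := b + 1
  let B : Set ℝ := {u, v} ∪ ⋃ k, {x | (l k 0 : ℝ) ≠ 0 ∧ x ∈ Set.Icc u v ∧ (l k 0 : ℝ) * x ∈ T k}
  have hB : B.Finite := by
    refine (Set.toFinite _).union (Set.finite_iUnion fun k => ?_)
    by_cases hk : (l k 0 : ℝ) = 0
    · simp [hk]
    · refine (((h𝒯.isLocallyFinite _ (hT k)) (|(l k 0 : ℝ)| * max |u| |v|)).preimage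
        (mul_right_injective₀ hk).injOn).subset ?_
      rintro x ⟨-, hx, hxT⟩
      refine ⟨hxT, abs_le.1 ?_⟩
      rw [abs_mul]
      exact mul_le_mul_of_nonneg_left (abs_le_max_abs_abs hx.1 hx.2) (abs_nonneg _)
  have huB : u ∈ B := Or.inl (Or.inl rfl)
  have hvB : v ∈ B := Or.inl (Or.inr rfl)
  have hlow : ∀ x ∈ X, u < x := fun x hx => by
    have := ha hx
    simp only [u]
    linarith
  have hup : ∀ x ∈ X, x < v := fun x hx => by
    have := hb hx
    simp only [v]
    linarith
  refine isFiniteUnionPointsIntervals_of_sameCell hB (fun x hx => ⟨u, huB, hlow x hx⟩)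
    (fun x hx => ⟨v, hvB, hup x hx⟩) fun x hx y hxy => ?_
  refine (h (fun _ => x) (fun _ => y) fun k => ?_).1 hx
  simp only [ratFunctional, Fin.sum_univ_one]
  by_cases hk : l k 0 = 0
  · simp [hk, SameCell]
  refine SameCell.of_mul hk ?_
  rintro _ ⟨t, ht, rfl⟩
  have hk' : (l k 0 : ℝ) ≠ 0 := by exact_mod_cast hk
  have hxu := hlow x hx
  have hxv := hup x hx
  have hyu := (hxy u huB).2.1 hxu
  have hyv := (hxy v hvB).1.1 hxv
  push_cast
  by_cases hmem : (l k 0 : ℝ)⁻¹ * t ∈ Set.Icc u v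
  · exact hxy _ (Or.inr (Set.mem_iUnion.2 ⟨k, hk', hmem, by rwa [mul_inv_cancel_left₀ hk']⟩))
  · rw [Set.mem_Icc] at hmem
    grind

/-! ### Two sparse families -/

/-- The values of `∑ c i * ρ ^ n i` for fixed real coefficients `c` and varying exponents. -/
def geomSums (ρ : ℝ) {k : ℕ} (c : Fin k → ℝ) : Set ℝ :=
  Set.range fun n : Fin k → ℕ => ∑ i, c i * ρ ^ n i

/-- A sum of `k + 1` powers with coefficients `c` is `ρ ^ m * (c i + s)`, where `m` is the least
exponent, attained at `i`, and `s` is a shorter sum. The numbers `c i + s` are locally finite by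
induction, so the nonzero ones are bounded away from zero, and in a bounded interval only finitely
many `m` occur. -/
lemma isLocallyFinite_geomSums {ρ : ℝ} (hρ : 1 < ρ) :
    ∀ {k : ℕ} (c : Fin k → ℝ), IsLocallyFinite (geomSums ρ c) := by
  intro k
  induction k with
  | zero =>
    intro c M
    refine (Set.finite_singleton (0 : ℝ)).subset ?_
    rintro x ⟨⟨n, rfl⟩, -⟩
    simp
  | succ k ih =>
    intro c M
    let D : Set ℝ := ⋃ i : Fin (k + 1), (fun s => c i + s) '' geomSums ρ fun j => c (i.succAbove j)
    have hD : IsLocallyFinite D := by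
      intro R
      simp only [D, Set.iUnion_inter]
      refine Set.finite_iUnion fun i => ?_
      refine ((ih (fun j => c (i.succAbove j)) (R + |c i|)).image fun s => c i + s).subset ?_
      rintro _ ⟨⟨s, hs, rfl⟩, h1⟩
      refine ⟨s, ⟨hs, ?_⟩, rfl⟩
      have h2 := abs_le.1 (le_refl |c i|)
      exact ⟨by linarith [h1.1], by linarith [h1.2]⟩
    have hρ0 : 0 < ρ := by linarith
    have hsub : geomSums ρ c ⊆ ⋃ m : ℕ, (fun d => ρ ^ m * d) '' D := by
      rintro _ ⟨n, rfl⟩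
      obtain ⟨i, hi⟩ := Finite.exists_min n
      refine Set.mem_iUnion.2 ⟨n i, _, Set.mem_iUnion.2 ⟨i, _,
        ⟨fun j => n (i.succAbove j) - n i, rfl⟩, rfl⟩, ?_⟩
      simp only
      rw [Fin.sum_univ_succAbove _ i, mul_add, Finset.mul_sum, mul_comm]
      congr 1
      refine Finset.sum_congr rfl fun j _ => ?_
      rw [mul_left_comm, ← pow_add, Nat.add_sub_cancel' (hi _)]
    obtain ⟨ε, hε, hεD⟩ : ∃ ε > 0, ∀ d ∈ D, d ≠ 0 → ε ≤ |d| := by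
      by_cases hne : ((D ∩ Set.Icc (-1) 1) \ {0}).Nonempty
      · obtain ⟨d, hd, hmin⟩ := Set.exists_min_image _ (fun d => |d|) (hD 1).sdiff hne
        refine ⟨|d|, abs_pos.2 hd.2, fun x hx hx0 => ?_⟩
        by_cases h1 : |x| ≤ 1
        · exact hmin x ⟨⟨hx, abs_le.1 h1⟩, hx0⟩
        · have := abs_le.2 hd.1.2
          linarith
      · refine ⟨1, one_pos, fun x hx hx0 => ?_⟩
        by_contra h1
        exact hne ⟨x, ⟨hx, abs_le.1 (not_le.1 h1).le⟩, hx0⟩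
    obtain ⟨m₀, hm₀⟩ := pow_unbounded_of_one_lt (M / ε) hρ
    refine ((Set.finite_singleton (0 : ℝ)).union (Set.Finite.biUnion (Set.finite_Iio m₀)
      fun m _ => (hD M).image fun d => ρ ^ m * d)).subset ?_
    rintro x ⟨hx, hxM⟩
    obtain ⟨m, d, hd, rfl⟩ := Set.mem_iUnion.1 (hsub hx)
    by_cases hd0 : d = 0
    · left
      simp [hd0]
    right
    have habs : ρ ^ m * |d| ≤ M := by
      have := abs_le.2 hxM
      rwa [abs_mul, abs_of_pos (pow_pos hρ0 m)] at this
    have hone : 1 ≤ ρ ^ m := one_le_pow₀ hρ.le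
    refine Set.mem_biUnion (x := m) ?_ ⟨d, ⟨hd, abs_le.1 ?_⟩, rfl⟩
    · rw [Set.mem_Iio]
      by_contra hm
      have h1 : ρ ^ m₀ ≤ ρ ^ m := pow_le_pow_right₀ hρ.le (not_lt.1 hm)
      have h2 : ρ ^ m * ε ≤ M :=
        (mul_le_mul_of_nonneg_left (hεD d hd hd0) (pow_pos hρ0 m).le).trans habs
      rw [div_lt_iff₀ hε] at hm₀
      nlinarith
    · nlinarith [abs_nonneg d]

/-- The subsets of the sets `geomSums ρ c`, for all tuples of coefficients `c`. -/
def geomFamily (ρ : ℝ) : Set (Set ℝ) :=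
  {T | ∃ (k : ℕ) (c : Fin k → ℝ), T ⊆ geomSums ρ c}

lemma isSparseFamily_geomFamily {ρ : ℝ} (hρ : 1 < ρ) : IsSparseFamily (geomFamily ρ) where
  isLocallyFinite := by
    rintro T ⟨k, c, hT⟩
    exact (isLocallyFinite_geomSums hρ c).mono hT
  singleton_mem c := by
    refine ⟨1, fun _ => c, ?_⟩
    rintro _ rfl
    exact ⟨fun _ => 0, by simp⟩
  add_mem := by
    rintro S ⟨k, c, hS⟩ T ⟨k', c', hT⟩
    refine ⟨k + k', Fin.append c c', ?_⟩
    rintro _ ⟨s, hs, t, ht, rfl⟩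
    obtain ⟨n, rfl⟩ := hS hs
    obtain ⟨n', rfl⟩ := hT ht
    exact ⟨Fin.append n n', by simp [Fin.sum_univ_add]⟩
  mul_mem := by
    rintro q T ⟨k, c, hT⟩
    refine ⟨k, fun i => q * c i, ?_⟩
    rintro _ ⟨t, ht, rfl⟩
    obtain ⟨n, rfl⟩ := hT ht
    exact ⟨n, by simp [Finset.mul_sum, mul_assoc]⟩

lemma geomProgression_mem_geomFamily (ρ : ℝ) : geomProgression ρ ∈ geomFamily ρ := by
  refine ⟨1, fun _ => 1, ?_⟩
  rintro _ ⟨n, rfl⟩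
  exact ⟨fun _ => n, by simp⟩

/-- The subsets of the progressions `(1 / N) ℤ + f`. -/
def arithFamily : Set (Set ℝ) :=
  {T | ∃ (N : ℕ) (f : ℝ), N ≠ 0 ∧ ∀ t ∈ T, ∃ z : ℤ, t = z / N + f}

lemma isSparseFamily_arithFamily : IsSparseFamily arithFamily where
  isLocallyFinite := by
    rintro T ⟨N, f, hN, hT⟩ M
    have hN0 : (0 : ℝ) < N := by exact_mod_cast Nat.pos_of_ne_zero hN
    refine ((Set.finite_Icc ⌈N * (-M - f)⌉ ⌊N * (M - f)⌋).image
      fun z : ℤ => (z : ℝ) / N + f).subset ?_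
    rintro t ⟨ht, h1, h2⟩
    obtain ⟨z, rfl⟩ := hT t ht
    refine ⟨z, ⟨Int.ceil_le.2 ?_, Int.le_floor.2 ?_⟩, rfl⟩
    · rw [mul_comm, ← le_div_iff₀ hN0]
      linarith
    · rw [mul_comm, ← div_le_iff₀ hN0]
      linarith
  singleton_mem c := ⟨1, c, one_ne_zero, fun t ht => ⟨0, by simpa using ht⟩⟩
  add_mem := by
    rintro S ⟨N, f, hN, hS⟩ T ⟨N', f', hN', hT⟩
    refine ⟨N * N', f + f', mul_ne_zero hN hN', ?_⟩
    rintro _ ⟨s, hs, t, ht, rfl⟩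
    obtain ⟨z, rfl⟩ := hS s hs
    obtain ⟨z', rfl⟩ := hT t ht
    have h1 : (N : ℝ) ≠ 0 := by exact_mod_cast hN
    have h2 : (N' : ℝ) ≠ 0 := by exact_mod_cast hN'
    refine ⟨z * N' + z' * N, ?_⟩
    push_cast
    field_simp
    ring
  mul_mem := by
    rintro q T ⟨N, f, hN, hT⟩
    refine ⟨q.den * N, q * f, mul_ne_zero q.den_nz hN, ?_⟩
    rintro _ ⟨t, ht, rfl⟩
    obtain ⟨z, rfl⟩ := hT t ht
    refine ⟨q.num * z, ?_⟩
    have hq : (q : ℝ) = q.num / q.den := Rat.cast_def q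
    simp only
    rw [mul_add, Nat.cast_mul, Int.cast_mul, mul_div_mul_comm, ← hq]

lemma mem_arithFamily_of_subset {T : Set ℝ} (hT : T ⊆ Set.range ((↑) : ℤ → ℝ)) :
    T ∈ arithFamily := by
  refine ⟨1, 0, one_ne_zero, fun t ht => ?_⟩
  obtain ⟨z, rfl⟩ := hT ht
  exact ⟨z, by simp⟩

/-! ### Definable sets of cellular structures -/

/-- The function symbols are interpreted by rational affine maps and the relation symbols by
cellular sets. -/
structure IsCellularStructure (𝒯 : Set (Set ℝ)) (L : FirstOrder.Language.{0, 0}) [L.Structure ℝ] :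
    Prop where
  funMap_eq : ∀ {n} (f : L.Functions n), ∃ (l : Fin n → ℚ) (c : ℝ),
    ∀ v : Fin n → ℝ, funMap f v = ratFunctional l v + c
  relMap_cellular : ∀ {n} (R : L.Relations n), IsCellular 𝒯 {v : Fin n → ℝ | RelMap R v}

section

variable {𝒯 : Set (Set ℝ)} {L : FirstOrder.Language.{0, 0}} [L.Structure ℝ]

lemma IsCellularStructure.sum {L' : FirstOrder.Language.{0, 0}} [L'.Structure ℝ]
    (h : IsCellularStructure 𝒯 L) (h' : IsCellularStructure 𝒯 L') :
    IsCellularStructure 𝒯 (L.sum L') where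
  funMap_eq f := by
    rcases f with f | f
    · exact h.funMap_eq f
    · exact h'.funMap_eq f
  relMap_cellular R := by
    rcases R with R | R
    · exact h.relMap_cellular R
    · exact h'.relMap_cellular R

lemma isCellularStructure_constantsOn (A : Set ℝ) :
    IsCellularStructure 𝒯 (constantsOn A) where
  funMap_eq {n} f := by
    cases n with
    | zero => exact ⟨0, funMap f default, fun v => by
        rw [Subsingleton.elim v default]
        simp [ratFunctional]⟩
    | succ n => exact f.elim
  relMap_cellular R := R.elim

lemma IsCellularStructure.realize_term (h : IsCellularStructure 𝒯 L) {ι : Type} [Fintype ι]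
    (t : L.Term ι) :
    ∃ (l : ι → ℚ) (c : ℝ), ∀ w : ι → ℝ, t.realize w = ratFunctional l w + c := by
  classical
  induction t with
  | var i => exact ⟨Pi.single i 1, 0, fun w => by
      simp [ratFunctional, Pi.single_apply, apply_ite (Rat.cast : ℚ → ℝ)]⟩
  | func f ts ih =>
    obtain ⟨l, c, hf⟩ := h.funMap_eq f
    choose A b hA using ih
    refine ⟨fun i => ∑ j, l j * A j i, ∑ j, (l j : ℝ) * b j + c, fun w => ?_⟩
    rw [Term.realize_func, hf]
    simp only [ratFunctional, hA, mul_add, Finset.sum_add_distrib, Finset.mul_sum, Rat.cast_sum,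
      Rat.cast_mul, Finset.sum_mul, mul_assoc, ← add_assoc]
    rw [Finset.sum_comm]

/-- Quantifier elimination: every formula defines a cellular set. -/
lemma IsCellularStructure.realize_boundedFormula (h𝒯 : IsSparseFamily 𝒯)
    (h : IsCellularStructure 𝒯 L) {α : Type} [Fintype α] {n : ℕ} (φ : L.BoundedFormula α n) :
    IsCellular 𝒯 {w : α ⊕ Fin n → ℝ | φ.Realize (w ∘ Sum.inl) (w ∘ Sum.inr)} := by
  induction φ with
  | falsum => exact isCellular_const False
  | equal t₁ t₂ =>
    have := (isCellular_eq h𝒯).preimage h𝒯 (fun w => ![t₁.realize w, t₂.realize w])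
      (Fin.forall_fin_two.2 ⟨h.realize_term t₁, h.realize_term t₂⟩)
    simpa [BoundedFormula.Realize, Set.preimage] using this
  | rel R ts =>
    have := (h.relMap_cellular R).preimage h𝒯 (fun w j => (ts j).realize w)
      fun j => h.realize_term (ts j)
    simpa [BoundedFormula.Realize, Set.preimage] using this
  | imp φ ψ ihφ ihψ => exact ihφ.imp ihψ
  | all φ ih =>
    have := ih.forall h𝒯
    simpa [BoundedFormula.Realize, Set.preimage] using this

lemma IsCellularStructure.isCellular_of_definable₁ (h𝒯 : IsSparseFamily 𝒯)
    (h : IsCellularStructure 𝒯 L) {A X : Set ℝ} (hX : A.Definable₁ L X) :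
    IsCellular 𝒯 {w : Fin 1 → ℝ | w 0 ∈ X} := by
  obtain ⟨φ, hφ⟩ := hX
  have h' : IsCellularStructure 𝒯 (L[[A]]) := h.sum (isCellularStructure_constantsOn A)
  have := (h'.realize_boundedFormula h𝒯 φ).preimage h𝒯 (fun w => Sum.elim w Fin.elim0)
    (Sum.rec (fun i => h'.realize_term (ι := Fin 1) (Term.var i)) fun i => i.elim0)
  have e : {w : Fin 1 → ℝ | w 0 ∈ X} = {w | φ.Realize w} := hφ
  rw [e]
  convert this using 1
  ext w
  simp only [Set.mem_ofPred_eq, Set.mem_preimage, Formula.Realize]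
  exact iff_of_eq (congrArg (BoundedFormula.Realize φ w) (Subsingleton.elim _ _))

/-- A cellular structure that expands the ordered group of reals is almost o-minimal. -/
lemma IsCellularStructure.isAlmostOMinimal (h𝒯 : IsSparseFamily 𝒯)
    (h : IsCellularStructure 𝒯 L) (hL : ExpandsOrderedGroup L) : IsAlmostOMinimal L :=
  ⟨hL, fun _ hX hlo hhi =>
    (h.isCellular_of_definable₁ h𝒯 hX).isFiniteUnionPointsIntervals h𝒯 hlo hhi⟩

end

lemma isCellularStructure_ordGroupLang {𝒯 : Set (Set ℝ)} (h𝒯 : IsSparseFamily 𝒯) :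
    IsCellularStructure 𝒯 ordGroupLang where
  funMap_eq f := by
    cases f with
    | zero => exact ⟨0, 0, fun v => by simp [ratFunctional]; rfl⟩
    | add => exact ⟨1, 0, fun v => by simp [ratFunctional, Fin.sum_univ_two]; rfl⟩
  relMap_cellular R := by
    cases R with
    | lt => exact isCellular_lt h𝒯

lemma isCellularStructure_predLang {𝒯 : Set (Set ℝ)} {E : Set ℝ} (hE : E ∈ 𝒯) :
    IsCellularStructure 𝒯 (predLang E) where
  funMap_eq f := f.elim
  relMap_cellular R := by
    cases R with
    | mem => exact isCellular_mem hE 0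

lemma expandsOrderedGroup_sum (L' : FirstOrder.Language.{0, 0}) [L'.Structure ℝ] :
    ExpandsOrderedGroup (ordGroupLang.sum L') :=
  ⟨LHom.sumInl, inferInstance⟩

/-! ### Residues modulo a definable progression -/

lemma IsFiniteUnionPointsIntervals.finite_of_countable {S : Set ℝ} (hS : IsFiniteUnionPointsIntervals S)
    (hc : S.Countable) : S.Finite := by
  obtain ⟨P, I, hP, hI, rfl⟩ := hS
  refine hP.union (hI.biUnion fun p hp => ?_)
  rcases lt_or_ge p.1 p.2 with h | h
  · refine absurd (hc.mono (Set.subset_union_of_subset_right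
      (Set.subset_biUnion_of_mem (u := fun p : ℝ × ℝ => Set.Ioo p.1 p.2) hp) _)) fun hcount => ?_
    have h1 := Cardinal.mk_Ioo_real h
    have h2 := hcount.le_aleph0
    rw [h1] at h2
    exact absurd h2 (not_le.2 Cardinal.aleph0_lt_continuum)
  · rw [Set.Ioo_eq_empty (not_lt.2 h)]
    exact Set.finite_empty

section Definability

variable {L : FirstOrder.Language.{0, 0}} [L.Structure ℝ]

lemma definable_add_eq (hL : ExpandsOrderedGroup L) :
    (Set.univ : Set ℝ).Definable L {v : Fin 3 → ℝ | v 0 + v 2 = v 1} := by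
  obtain ⟨φ, hφ⟩ := hL
  refine Set.Definable.map_expansion (L := ordGroupLang) ?_ φ
  refine ⟨Term.equal (Term.func (Sum.inl OrdGroupFunc.add) ![Term.var 0, Term.var 2])
    (Term.var 1), ?_⟩
  ext v
  simp only [Set.mem_ofPred_eq, Formula.realize_equal, Term.realize_var]
  exact Iff.rfl

lemma definable_lt_const (hL : ExpandsOrderedGroup L) (r : ℝ) :
    (Set.univ : Set ℝ).Definable₁ L {x | x < r} := by
  obtain ⟨φ, hφ⟩ := hL
  refine Set.Definable.map_expansion (L := ordGroupLang) ?_ φ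
  refine ⟨Relations.formula (L := ordGroupLang[[Set.univ]]) (Sum.inl OrdGroupRel.lt)
    ![Term.var 0, Constants.term (ordGroupLang.con (⟨r, trivial⟩ : (Set.univ : Set ℝ)))], ?_⟩
  ext v
  simp only [Set.mem_ofPred_eq]
  exact Iff.rfl

/-- In an almost o-minimal expansion, a definable countable set has only finitely many residues
modulo a definable set `r ℤ`: they form a bounded, definable, countable set. -/
lemma exists_finite_residues (hL : IsAlmostOMinimal L) {E : Set ℝ}
    (hE : (Set.univ : Set ℝ).Definable₁ L E) (hEc : E.Countable) {r : ℝ} (hr : 0 < r)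
    (hZ : (Set.univ : Set ℝ).Definable₁ L (Set.range fun z : ℤ => r * (z : ℝ))) :
    ∃ F : Set ℝ, F.Finite ∧ ∀ e ∈ E, ∃ f ∈ F, ∃ z : ℤ, f + r * z = e := by
  have hdef : (Set.univ : Set ℝ).Definable L {v : Fin 3 → ℝ | v 0 + v 2 = v 1 ∧ v 1 ∈ E ∧
      v 2 ∈ (Set.range fun z : ℤ => r * (z : ℝ)) ∧ v 0 < r ∧ ¬ v 0 < 0} :=
    (definable_add_eq hL.1).inter <| (hE.preimage_comp fun _ : Fin 1 => (1 : Fin 3)).inter <|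
      (hZ.preimage_comp fun _ : Fin 1 => (2 : Fin 3)).inter <|
      ((definable_lt_const hL.1 r).preimage_comp fun _ : Fin 1 => (0 : Fin 3)).inter
      ((definable_lt_const hL.1 0).preimage_comp fun _ : Fin 1 => (0 : Fin 3)).compl
  let F : Set ℝ := {x | ∃ e ∈ E, ∃ z : ℤ, x + r * z = e ∧ x < r ∧ ¬ x < 0}
  have hF : (Set.univ : Set ℝ).Definable₁ L F := by
    have := hdef.image_comp (fun _ : Fin 1 => (0 : Fin 3))
    have e : {x : Fin 1 → ℝ | x 0 ∈ F} = (fun g : Fin 3 → ℝ => g ∘ fun _ : Fin 1 => (0 : Fin 3)) ''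
        {v : Fin 3 → ℝ | v 0 + v 2 = v 1 ∧ v 1 ∈ E ∧
          v 2 ∈ (Set.range fun z : ℤ => r * (z : ℝ)) ∧ v 0 < r ∧ ¬ v 0 < 0} := by
      ext x
      constructor
      · rintro ⟨e, he, z, h1, h2, h3⟩
        refine ⟨![x 0, e, r * z], ⟨h1, he, ⟨z, rfl⟩, h2, h3⟩, ?_⟩
        ext i
        rw [Subsingleton.elim i 0]
        rfl
      · rintro ⟨v, ⟨h1, he, ⟨z, hz⟩, h2, h3⟩, rfl⟩
        exact ⟨v 1, he, z, (congrArg (v 0 + ·) hz).trans h1, h2, h3⟩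
    rw [Set.Definable₁, e]
    exact this
  have hFc : F.Countable := by
    refine (Set.Countable.biUnion hEc fun e _ =>
      Set.countable_range fun z : ℤ => e - r * (z : ℝ)).mono ?_
    rintro x ⟨e, he, z, h, -⟩
    exact Set.mem_biUnion he ⟨z, by simp only; linarith⟩
  refine ⟨F, (hL.2 F hF ⟨0, ?_⟩ ⟨r, ?_⟩).finite_of_countable hFc, fun e he => ?_⟩
  · rintro x ⟨e, he, z, h, h1, h2⟩
    exact not_lt.1 h2
  · rintro x ⟨e, he, z, h, h1, h2⟩
    exact h1.le
  · refine ⟨e - r * ⌊e / r⌋, ⟨e, he, ⌊e / r⌋, by ring, ?_, ?_⟩, ⌊e / r⌋, by ring⟩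
    · have := Int.lt_floor_add_one (e / r)
      rw [div_lt_iff₀ hr] at this
      linarith
    · have := Int.floor_le (e / r)
      rw [le_div_iff₀ hr] at this
      linarith

end Definability

/-! ### Powers with finitely many residues -/

/-- If the powers of `ρ` have finitely many residues modulo `r ℤ`, then the ring `ℤ[ρ]` lies in the
finitely generated group spanned by `r` and the residues, so that `ρ` is integral. -/
lemma isIntegral_of_finite_residues {ρ r : ℝ} {F : Set ℝ} (hF : F.Finite)
    (h : ∀ n : ℕ, ∃ f ∈ F, ∃ z : ℤ, f + r * z = ρ ^ n) : IsIntegral ℤ ρ := by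
  let M : Submodule ℤ ℝ := Submodule.span ℤ (insert r F)
  have hM : M.FG := Submodule.fg_span (hF.insert r)
  have : IsNoetherian ℤ M := isNoetherian_of_fg_of_noetherian M hM
  have hle : Subalgebra.toSubmodule (Algebra.adjoin ℤ {ρ}) ≤ M := by
    rw [Algebra.adjoin_eq_span, Submodule.span_le]
    intro x hx
    obtain ⟨n, rfl⟩ := Submonoid.mem_closure_singleton.1 hx
    obtain ⟨f, hf, z, hz⟩ := h n
    rw [← hz]
    refine M.add_mem (Submodule.subset_span (Or.inr hf)) ?_
    rw [mul_comm, ← zsmul_eq_mul]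
    exact M.smul_mem z (Submodule.subset_span (Or.inl rfl))
  exact IsIntegral.of_mem_of_fg (Algebra.adjoin ℤ {ρ}) (isNoetherian_submodule.1 this _ hle) ρ
    (Algebra.self_mem_adjoin_singleton ℤ ρ)

/-- If the powers of `ρ > 1` have finitely many residues modulo `r ℤ`, then `ρ` is an integer. Two
blocks of consecutive powers, as long as the degree of a monic equation of `ρ`, have the same
residues; by the equation, all multiples of `C = ρ ^ n - ρ ^ m` by powers of `ρ` then lie in `r ℤ`.
Hence `ρ = C ρ / C` is rational, and a rational algebraic integer is an integer. -/
lemma exists_int_of_finite_residues {ρ r : ℝ} (hρ : 1 < ρ) {F : Set ℝ} (hF : F.Finite)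
    (h : ∀ n : ℕ, ∃ f ∈ F, ∃ z : ℤ, f + r * z = ρ ^ n) : ∃ k : ℤ, ρ = k := by
  have hint := isIntegral_of_finite_residues hF h
  obtain ⟨p, hp, hp0⟩ := id hint
  choose f hfF z hz using h
  have : Finite F := hF
  obtain ⟨m, n, hmn, heq⟩ := Finite.exists_ne_map_eq_of_infinite
    fun n (i : Fin p.natDegree) => (⟨f (n + i), hfF _⟩ : F)
  let C := ρ ^ m - ρ ^ n
  have hC : C ≠ 0 := sub_ne_zero.2 fun e => hmn (pow_right_injective₀ (by linarith) hρ.ne' e)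
  have hlow : ∀ i < p.natDegree, ∃ y : ℤ, C * ρ ^ i = r * y := by
    intro i hi
    have h1 : f (m + i) = f (n + i) := congrArg Subtype.val (congrFun heq ⟨i, hi⟩)
    refine ⟨z (m + i) - z (n + i), ?_⟩
    have h2 := hz (m + i)
    have h3 := hz (n + i)
    simp only [C, sub_mul, ← pow_add, Int.cast_sub, mul_sub]
    linarith
  have hall : ∀ j : ℕ, ∃ y : ℤ, C * ρ ^ j = r * y := by
    intro j
    let q := (Polynomial.X ^ j : Polynomial ℤ) %ₘ p
    have hq : ρ ^ j = Polynomial.aeval ρ q := by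
      rw [Polynomial.aeval_modByMonic_eq_self_of_root hp0]
      simp
    rw [hq, Polynomial.aeval_eq_sum_range, Finset.mul_sum]
    have hterm : ∀ i, ∃ y : ℤ, C * q.coeff i • ρ ^ i = r * y := by
      intro i
      by_cases hi : i < p.natDegree
      · obtain ⟨y, hy⟩ := hlow i hi
        refine ⟨q.coeff i * y, ?_⟩
        rw [zsmul_eq_mul, mul_left_comm, hy]
        push_cast
        ring
      · refine ⟨0, ?_⟩
        have hdeg : q.coeff i = 0 := by
          refine Polynomial.coeff_eq_zero_of_degree_lt
            ((Polynomial.degree_modByMonic_lt _ hp).trans_le ?_)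
          rw [Polynomial.degree_eq_natDegree hp.ne_zero]
          exact_mod_cast not_lt.1 hi
        simp [hdeg]
    choose y hy using hterm
    refine ⟨∑ i ∈ Finset.range (q.natDegree + 1), y i, ?_⟩
    rw [Finset.sum_congr rfl fun i _ => hy i, ← Finset.mul_sum]
    push_cast
    rfl
  obtain ⟨a, ha⟩ := hall 0
  obtain ⟨b, hb⟩ := hall 1
  rw [pow_zero, mul_one] at ha
  rw [pow_one, ha] at hb
  have hr0 : r ≠ 0 := fun e => hC (by rw [ha, e, zero_mul])
  have ha0 : (a : ℝ) ≠ 0 := fun e => hC (by rw [ha, e, mul_zero])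
  have hρq : ρ = algebraMap ℚ ℝ (b / a : ℚ) := by
    have h1 : (a : ℝ) * ρ = b := mul_left_cancel₀ hr0 (by rw [← hb, mul_assoc])
    simp only [eq_ratCast, Rat.cast_div, Rat.cast_intCast]
    rw [eq_div_iff ha0, mul_comm, h1]
  rw [hρq, isIntegral_algebraMap_iff (algebraMap ℚ ℝ).injective] at hint
  obtain ⟨k, hk⟩ := IsIntegrallyClosed.isIntegral_iff.1 hint
  exact ⟨k, by rw [hρq, ← hk]; simp⟩

/-! ### Geometric progressions -/

lemma exists_int_of_isQuasiPeriodic {ρ : ℝ} (hρ : 1 < ρ)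
    (h : IsQuasiPeriodic (ordGroupWithLang (geomProgression ρ))) : ∃ k : ℤ, ρ = k := by
  obtain ⟨-, L', _, φ, hφ, hL', r, hr, hZ⟩ := h
  have hE : (Set.univ : Set ℝ).Definable₁ (ordGroupWithLang (geomProgression ρ))
      (geomProgression ρ) := by
    refine ⟨Relations.formula (L := (ordGroupWithLang (geomProgression ρ))[[Set.univ]])
      (Sum.inl (Sum.inr UnaryRel.mem)) ![Term.var 0], ?_⟩
    ext v
    simp only [Set.mem_ofPred_eq]
    exact Iff.rfl
  obtain ⟨F, hF, hres⟩ := exists_finite_residues hL'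
    (Set.Definable.map_expansion hE φ) (Set.countable_range _) hr hZ
  exact exists_int_of_finite_residues hρ hF fun n => hres _ ⟨n, rfl⟩

/-- For an integer `k`, all powers of `k` are integers, so the structure with both `k ^ ℕ` and `ℤ` is
cellular for the arithmetic family, hence almost o-minimal. -/
lemma isQuasiPeriodic_of_int {k : ℤ}
    (hL : IsAlmostOMinimal (ordGroupWithLang (geomProgression k))) :
    IsQuasiPeriodic (ordGroupWithLang (geomProgression k)) := by
  refine ⟨hL, (ordGroupWithLang (geomProgression k)).sum (predLang (Set.range ((↑) : ℤ → ℝ))),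
    inferInstance, LHom.sumInl, inferInstance, ?_, 1, one_pos, ?_⟩
  · refine IsCellularStructure.isAlmostOMinimal isSparseFamily_arithFamily
      (((isCellularStructure_ordGroupLang isSparseFamily_arithFamily).sum
        (isCellularStructure_predLang ?_)).sum (isCellularStructure_predLang ?_))
      ⟨LHom.sumInl.comp LHom.sumInl, ⟨fun _ _ => rfl, fun _ _ => rfl⟩⟩
    · refine mem_arithFamily_of_subset ?_
      rintro _ ⟨n, rfl⟩
      exact ⟨k ^ n, by push_cast; rfl⟩
    · exact mem_arithFamily_of_subset subset_rfl
  · refine ⟨Relations.formula (L := ((ordGroupWithLang (geomProgression k)).sum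
      (predLang (Set.range ((↑) : ℤ → ℝ))))[[Set.univ]])
      (Sum.inl (Sum.inr UnaryRel.mem)) ![Term.var 0], ?_⟩
    ext v
    simp only [Set.mem_ofPred_eq, one_mul]
    exact Iff.rfl

lemma isAlmostOMinimal_geomProgression {ρ : ℝ} (hρ : 1 < ρ) :
    IsAlmostOMinimal (ordGroupWithLang (geomProgression ρ)) :=
  have h𝒯 := isSparseFamily_geomFamily hρ
  ((isCellularStructure_ordGroupLang h𝒯).sum (isCellularStructure_predLang
    (geomProgression_mem_geomFamily ρ))).isAlmostOMinimal h𝒯 (expandsOrderedGroup_sum _)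

end QuasiPeriodic

theorem mainTheorem2 (ρ : ℝ) (hρ : 1 < ρ) :
    QuasiPeriodic.IsAlmostOMinimal
        (QuasiPeriodic.ordGroupWithLang (QuasiPeriodic.geomProgression ρ)) ∧
      (QuasiPeriodic.IsQuasiPeriodic
          (QuasiPeriodic.ordGroupWithLang (QuasiPeriodic.geomProgression ρ)) ↔
        ∃ k : ℤ, ρ = (k : ℝ)) := by
  refine ⟨QuasiPeriodic.isAlmostOMinimal_geomProgression hρ,
    QuasiPeriodic.exists_int_of_isQuasiPeriodic hρ, ?_⟩
  rintro ⟨k, rfl⟩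
  exact QuasiPeriodic.isQuasiPeriodic_of_int (QuasiPeriodic.isAlmostOMinimal_geomProgression hρ)
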